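/- All graphs are finite, simple and have nonempty vertex set. For a graph $G$, let $\mu(S)=|S|/|V(G)|$ for $S\subseteq V(G)$, let $\beta(G)=\alpha(G)/|V(G)|$, where $\alpha(G)$ is the largest size of an independent set in $G$, and let $\partial S=\{w\in V(G):\{v,w\}\in E(G)\text{ for some }v\in S\}$ for $S\subseteq V(G)$. For $\nu\in[0,1]$ let \[\Phi(G,\nu)=\min\{\mu(\partial S):S\subseteq V(G),\ \mu(S)\geq\nu\}.\] The direct product $H_1\times\cdots\times H_n$ is the graph with vertex set $V(H_1)\times\cdots\times V(H_n)$ in which $(g_1,\ldots,g_n)$ and $(g_1',\ldots,g_n')$ are adjacent if and only if $\{g_i,g_i'\}\in E(H_i)$ for all $i$. Corollary. Let $n\geq 1$ and let $H_1,\ldots,H_n$ be complete multipartite graphs with $\beta(H_1)\leq\cdots\leq\beta(H_n)\leq 1/2$. Then for every $\nu\in[0,1]$, \[\Phi(H_1\times\cdots\times H_n,\nu)\geq\nu^{\log_{\beta(H_n)}(1-\beta(H_n))}.\] -/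

import Mathlib

namespace GraphIso

/-- The direct (tensor) product of a nonempty family of graphs: two tuples are adjacent iff they are
adjacent in every coordinate. (Nonemptiness of the index type makes this relation loopless.) -/
def directProduct {ι : Type*} [Nonempty ι] {V : ι → Type*} (H : ∀ i, SimpleGraph (V i)) :
    SimpleGraph (∀ i, V i) where
  Adj g g' := ∀ i, (H i).Adj (g i) (g' i)
  symm := ⟨fun _ _ h i => (h i).symm⟩
  loopless := ⟨fun _ h => (H (Classical.arbitrary ι)).irrefl (h (Classical.arbitrary ι))⟩

/-- The independence ratio `β(G) = α(G) / |V(G)|`. -/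
noncomputable def indepRatio {V : Type*} (G : SimpleGraph V) : ℝ :=
  (G.indepNum : ℝ) / (Nat.card V : ℝ)

/-- The uniform probability measure `μ(S) = |S| / |V|` on a finite nonempty type. -/
noncomputable def unifMeas {V : Type*} (S : Set V) : ℝ :=
  (S.ncard : ℝ) / (Nat.card V : ℝ)

/-- The vertex boundary of `S`: all vertices having a neighbour in `S` (elements of `S` allowed). -/
def vertexBoundary {V : Type*} (G : SimpleGraph V) (S : Set V) : Set V :=
  {w | ∃ v ∈ S, G.Adj v w}

/-- The vertex isoperimetric profile `Φ(G, ν) = min {μ(∂S) : S ⊆ V(G), μ(S) ≥ ν}` with respect to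
the uniform measure. The infimum is a minimum for `ν ≤ 1`, see `isLeast_isoProfile`. -/
noncomputable def isoProfile {V : Type*} (G : SimpleGraph V) (ν : ℝ) : ℝ :=
  sInf {x : ℝ | ∃ S : Set V, ν ≤ unifMeas S ∧ unifMeas (vertexBoundary G S) = x}

/-- On a finite nonempty vertex set the infimum in `isoProfile` is attained for every `ν ≤ 1`. -/
theorem isLeast_isoProfile {V : Type*} [Finite V] [Nonempty V] (G : SimpleGraph V) {ν : ℝ}
    (hν : ν ≤ 1) :
    IsLeast {x : ℝ | ∃ S : Set V, ν ≤ unifMeas S ∧ unifMeas (vertexBoundary G S) = x}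
      (isoProfile G ν) := by
  have hfin : {x : ℝ | ∃ S : Set V, ν ≤ unifMeas S ∧
      unifMeas (vertexBoundary G S) = x}.Finite := by
    refine (Set.finite_range (fun S : Set V => unifMeas (vertexBoundary G S))).subset ?_
    rintro x ⟨S, -, rfl⟩
    exact ⟨S, rfl⟩
  have hne : {x : ℝ | ∃ S : Set V, ν ≤ unifMeas S ∧
      unifMeas (vertexBoundary G S) = x}.Nonempty := by
    refine ⟨_, Set.univ, ?_, rfl⟩
    have h0 : (Nat.card V : ℝ) ≠ 0 := by exact_mod_cast Nat.card_pos.ne'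
    simpa [unifMeas, Set.ncard_univ, div_self h0] using hν
  exact ⟨hne.csInf_mem hfin, fun x hx => csInf_le hfin.bddBelow hx⟩

end GraphIso

namespace GraphIso

/-! Write b for the largest independence ratio and c = log_b(1 - b), so b^c = 1 - b. The bound μ(∂S)
≥ μ(S)^c tensorizes one factor at a time (`PowerExpanding.prod`). Slice S over a factor, take a
largest slice, of measure M, and let A be the part containing its vertex, a = μ(A) ≤ b. If m is the
largest slice measure off A, then μ(S) ≤ aM + (1-a)m. Vertices off A see the M-slice and those in A
see the m-slice, so μ(∂S) ≥ (1-a)M^c + am^c by induction. `rpow_two_point_le` compares the two. -/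

/-- Two-point inequality behind the tensorization step, a consequence of Minkowski's inequality. -/
theorem rpow_two_point_le {a c m M : ℝ} (ha0 : 0 ≤ a) (ha1 : a ≤ 1) (hc0 : 0 < c) (hc1 : c ≤ 1)
    (hac : a ^ c ≤ 1 - a) (hm : 0 ≤ m) (hmM : m ≤ M) :
    (a * M + (1 - a) * m) ^ c ≤ (1 - a) * M ^ c + a * m ^ c := by
  have hM : 0 ≤ M := hm.trans hmM
  have hb0 : 0 ≤ 1 - a := by linarith
  have hp : 1 ≤ 1 / c := by rw [le_div_iff₀ hc0]; linarith
  have hxy : m ^ c ≤ M ^ c := Real.rpow_le_rpow hm hmM hc0.le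
  have hy : 0 ≤ m ^ c := Real.rpow_nonneg hm c
  have hac0 : 0 ≤ a ^ c := Real.rpow_nonneg ha0 c
  have hbc0 : 0 ≤ (1 - a) ^ c := Real.rpow_nonneg hb0 c
  have hinv : ∀ x : ℝ, 0 ≤ x → (x ^ c) ^ (1 / c) = x := fun x hx => by
    rw [one_div, Real.rpow_rpow_inv hx hc0.ne']
  have hinv' : ∀ x : ℝ, 0 ≤ x → (x ^ (1 / c)) ^ c = x := fun x hx => by
    rw [one_div, Real.rpow_inv_rpow hx hc0.ne']
  -- The vectors sum to ((aM)^c, ((1-a)m)^c), and their ℓ^(1/c) norms are a^c(M^c - m^c) and m^c.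
  have key := Real.Lp_add_le_of_nonneg (Finset.univ : Finset (Fin 2)) (p := 1 / c)
    (f := ![a ^ c * (M ^ c - m ^ c), 0]) (g := ![a ^ c * m ^ c, (1 - a) ^ c * m ^ c]) hp
    (by intro i _; fin_cases i
        · exact mul_nonneg hac0 (sub_nonneg.2 hxy)
        · exact le_rfl)
    (by intro i _; fin_cases i
        · exact mul_nonneg hac0 hy
        · exact mul_nonneg hbc0 hy)
  have hz : (0 : ℝ) ^ (1 / c) = 0 := Real.zero_rpow (by positivity)
  have e1 : a ^ c * (M ^ c - m ^ c) + a ^ c * m ^ c = (a * M) ^ c := by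
    rw [Real.mul_rpow ha0 hM]; ring
  simp only [Fin.sum_univ_two, Matrix.cons_val_zero, Matrix.cons_val_one, zero_add, hz, add_zero,
    e1, one_div_one_div] at key
  rw [← Real.mul_rpow ha0 hm, ← Real.mul_rpow hb0 hm, hinv _ (mul_nonneg ha0 hM),
    hinv _ (mul_nonneg ha0 hm), hinv _ (mul_nonneg hb0 hm),
    hinv' _ (mul_nonneg hac0 (sub_nonneg.2 hxy)), ← add_mul, add_sub_cancel, one_mul] at key
  nlinarith [mul_le_mul_of_nonneg_right hac (sub_nonneg.2 hxy)]

theorem unifMeas_nonneg {V : Type*} (S : Set V) : 0 ≤ unifMeas S := by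
  unfold unifMeas; positivity

theorem unifMeas_mono {V : Type*} [Finite V] {S T : Set V} (h : S ⊆ T) :
    unifMeas S ≤ unifMeas T := by
  unfold unifMeas
  have := Set.ncard_le_ncard h (Set.toFinite T)
  gcongr

theorem unifMeas_preimage_equiv {V W : Type*} (e : V ≃ W) (S : Set W) :
    unifMeas (e ⁻¹' S) = unifMeas S := by
  unfold unifMeas
  rw [Nat.card_congr e, Set.ncard_preimage_of_injective_subset_range e.injective (by simp)]

theorem unifMeas_prod_eq_sum {V W : Type*} [Fintype V] [Finite W] (S : Set (V × W)) :
    unifMeas S = (∑ v, unifMeas {w | (v, w) ∈ S}) / Nat.card V := by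
  classical
  have h : S.ncard = ∑ v, {w | (v, w) ∈ S}.ncard := by
    have e : S ≃ Σ v, {w | (v, w) ∈ S} :=
      { toFun := fun x => ⟨x.1.1, x.1.2, x.2⟩
        invFun := fun y => ⟨(y.1, y.2.1), y.2.2⟩
        left_inv := fun _ => rfl
        right_inv := fun _ => rfl }
    rw [← Nat.card_coe_set_eq, Nat.card_congr e, Nat.card_sigma]
    rfl
  unfold unifMeas
  rw [h, ← Finset.sum_div, Nat.card_prod, div_div, mul_comm (Nat.card W : ℝ)]
  push_cast
  rfl

/-- The set of points related to some point of `S`. -/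
def relBoundary {V : Type*} (R : V → V → Prop) (S : Set V) : Set V := {w | ∃ v ∈ S, R v w}

/-- `μ(∂S) ≥ μ(S) ^ c` for all `S`, where `∂` is taken with respect to the relation `R`. -/
def PowerExpanding {V : Type*} (R : V → V → Prop) (c : ℝ) : Prop :=
  ∀ S : Set V, unifMeas S ^ c ≤ unifMeas (relBoundary R S)

theorem PowerExpanding.of_equiv {V W : Type*} {R : V → V → Prop} {Q : W → W → Prop} {c : ℝ}
    (e : V ≃ W) (h : ∀ v w, R v w ↔ Q (e v) (e w)) (hQ : PowerExpanding Q c) :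
    PowerExpanding R c := by
  intro S
  have h1 := hQ (e.symm ⁻¹' S)
  rw [unifMeas_preimage_equiv, ← unifMeas_preimage_equiv e] at h1
  convert h1 using 2
  ext w
  constructor
  · rintro ⟨v, hv, hvw⟩
    exact ⟨e v, by simpa using hv, (h v w).1 hvw⟩
  · rintro ⟨v, hv, hvw⟩
    exact ⟨e.symm v, hv, (h _ _).2 (by simpa using hvw)⟩

/-- Base case: on the empty product adjacency holds vacuously, hence is reflexive. This loop is why
expansion is stated for relations rather than simple graphs. -/
theorem powerExpanding_of_subsingleton {V : Type*} [Finite V] [Subsingleton V]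
    {R : V → V → Prop} {c : ℝ} (hc : 0 < c) (hR : ∀ v, R v v) : PowerExpanding R c := by
  intro S
  rcases S.eq_empty_or_nonempty with rfl | ⟨v, hv⟩
  · simpa [unifMeas, Real.zero_rpow hc.ne'] using unifMeas_nonneg _
  · have hS : S ⊆ relBoundary R S := fun x hx => ⟨x, hx, hR x⟩
    have h1 : unifMeas S = 1 := by
      have : Unique V := ⟨⟨v⟩, fun _ => Subsingleton.elim _ _⟩
      have : S = {v} := Set.eq_singleton_iff_unique_mem.2 ⟨hv, fun _ _ => Subsingleton.elim _ _⟩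
      simp [unifMeas, this]
    calc unifMeas S ^ c = unifMeas S := by rw [h1, Real.one_rpow]
      _ ≤ _ := unifMeas_mono hS

/-- Averaging a function equal to `x` on `A` and `y` off `A`. -/
theorem sum_ite_div_card {V : Type*} [Fintype V] [Nonempty V] (A : Set V)
    [DecidablePred (· ∈ A)] (x y : ℝ) :
    (∑ v, if v ∈ A then x else y) / Nat.card V = unifMeas A * x + (1 - unifMeas A) * y := by
  have hN : (Nat.card V : ℝ) ≠ 0 := by exact_mod_cast Nat.card_pos.ne'
  have h : (∑ v, if v ∈ A then x else y) = ∑ v, ((if v ∈ A then x - y else 0) + y) :=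
    Finset.sum_congr rfl fun v _ => by split_ifs <;> ring
  have hA : (Finset.univ.filter (· ∈ A)).card = A.ncard := by
    rw [← Set.ncard_coe_finset]; simp
  rw [h, Finset.sum_add_distrib, ← Finset.sum_filter, Finset.sum_const, Finset.sum_const, hA,
    Finset.card_univ, ← Nat.card_eq_fintype_card, unifMeas]
  simp only [nsmul_eq_mul]
  field_simp
  ring

/-- Tensorization: a complete multipartite factor with small parts preserves `PowerExpanding`. -/
theorem PowerExpanding.prod {V W : Type*} [Finite V] [Nonempty V] [Finite W]
    {G : SimpleGraph V} {R : W → W → Prop} {b c : ℝ} (hG : G.IsCompleteMultipartite)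
    (hGb : indepRatio G ≤ b) (hb1 : b < 1) (hc0 : 0 < c) (hc1 : c ≤ 1) (hbc : b ^ c ≤ 1 - b)
    (hR : PowerExpanding R c) :
    PowerExpanding (fun x y : V × W => G.Adj x.1 y.1 ∧ R x.2 y.2) c := by
  classical
  have := Fintype.ofFinite V
  intro S
  set f : V → ℝ := fun v => unifMeas {w | (v, w) ∈ S} with hf
  obtain ⟨v₀, hv₀⟩ := Finite.exists_max f
  set A : Set V := {v | ¬ G.Adj v₀ v} with hA
  have hAb : unifMeas A ≤ b := by
    refine le_trans ?_ hGb
    have hind : G.IsIndepSet (A.toFinset : Set V) := by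
      intro x hx y hy _ hxy
      simp only [Set.coe_toFinset] at hx hy
      exact hG.trans x v₀ y (fun h => hx h.symm) hy hxy
    have hle : A.ncard ≤ G.indepNum := by
      rw [Set.ncard_eq_toFinset_card']
      exact hind.card_le_indepNum
    unfold unifMeas indepRatio
    gcongr
  have ha0 := unifMeas_nonneg A
  -- a^c ≤ b^c ≤ 1 - b ≤ 1 - a.
  have hac : unifMeas A ^ c ≤ 1 - unifMeas A := by
    have := Real.rpow_le_rpow ha0 hAb hc0.le
    linarith
  obtain ⟨u, hu⟩ : ∃ u, u ∉ A := by
    by_contra! h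
    have hAu : A = Set.univ := Set.eq_univ_of_forall h
    have : unifMeas A = 1 := by simp [unifMeas, hAu, Set.ncard_univ]
    linarith
  obtain ⟨v₁, hv₁A, hv₁⟩ := Set.exists_max_image Aᶜ f (Set.toFinite _) ⟨u, hu⟩
  have hS : unifMeas S ≤ unifMeas A * f v₀ + (1 - unifMeas A) * f v₁ := by
    rw [unifMeas_prod_eq_sum, ← sum_ite_div_card]
    gcongr with v
    split_ifs with h
    · exact hv₀ v
    · exact hv₁ v h
  have hfib : ∀ v v', G.Adj v v' → f v ^ c ≤
      unifMeas {w | (v', w) ∈ relBoundary (fun x y : V × W => G.Adj x.1 y.1 ∧ R x.2 y.2) S} := by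
    intro v v' hvv'
    refine (hR _).trans (unifMeas_mono ?_)
    rintro w ⟨w', hw', hww'⟩
    exact ⟨(v, w'), hw', hvv', hww'⟩
  have hB : unifMeas A * f v₁ ^ c + (1 - unifMeas A) * f v₀ ^ c ≤
      unifMeas (relBoundary (fun x y : V × W => G.Adj x.1 y.1 ∧ R x.2 y.2) S) := by
    rw [unifMeas_prod_eq_sum, ← sum_ite_div_card]
    gcongr with v
    split_ifs with h
    -- Non-adjacency is transitive, so a vertex of A not adjacent to v₁ would put v₁ in A.
    · refine hfib _ _ (not_not.1 fun h' => hv₁A ?_)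
      exact hG.trans _ _ _ h fun h'' => h' h''.symm
    · exact hfib _ _ (not_not.1 h)
  have h2 := rpow_two_point_le ha0 (hAb.trans hb1.le) hc0 hc1 hac (unifMeas_nonneg _) (hv₀ v₁)
  have h1 := Real.rpow_le_rpow (unifMeas_nonneg S) hS hc0.le
  linarith

theorem powerExpanding_pi {b c : ℝ} (hb1 : b < 1) (hc0 : 0 < c) (hc1 : c ≤ 1)
    (hbc : b ^ c ≤ 1 - b) : ∀ {n : ℕ} {V : Fin n → Type*} [∀ i, Finite (V i)]
    [∀ i, Nonempty (V i)] (H : ∀ i, SimpleGraph (V i)),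
    (∀ i, (H i).IsCompleteMultipartite) → (∀ i, indepRatio (H i) ≤ b) →
    PowerExpanding (fun x y : ∀ i, V i => ∀ i, (H i).Adj (x i) (y i)) c := by
  intro n
  induction n with
  | zero =>
    intro V _ _ H _ _
    exact powerExpanding_of_subsingleton hc0 fun _ i => i.elim0
  | succ n ih =>
    intro V _ _ H hH hHb
    refine PowerExpanding.of_equiv (Fin.consEquiv V).symm (fun x y => ?_)
      (PowerExpanding.prod (hH 0) (hHb 0) hb1 hc0 hc1 hbc
        (ih (fun i : Fin n => H i.succ) (fun i => hH i.succ) fun i => hHb i.succ))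
    exact Fin.forall_fin_succ

theorem indepRatio_pos {V : Type*} [Finite V] [Nonempty V] (G : SimpleGraph V) :
    0 < indepRatio G := by
  have := Fintype.ofFinite V
  obtain ⟨v⟩ := ‹Nonempty V›
  have h : 1 ≤ G.indepNum := by
    have hi : G.IsIndepSet (({v} : Finset V) : Set V) := by simp [SimpleGraph.IsIndepSet]
    simpa using hi.card_le_indepNum
  have hV : 0 < Nat.card V := Nat.card_pos
  unfold indepRatio
  have : (0 : ℝ) < G.indepNum := by exact_mod_cast h
  positivity

end GraphIso

theorem corollary1p6 {n : ℕ} {V : Fin (n + 1) → Type*} [∀ i, Finite (V i)] [∀ i, Nonempty (V i)]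
    (H : ∀ i, SimpleGraph (V i))
    (hH : ∀ i, (H i).IsCompleteMultipartite)
    (hmono : ∀ i j, i ≤ j → GraphIso.indepRatio (H i) ≤ GraphIso.indepRatio (H j))
    (hhalf : GraphIso.indepRatio (H (Fin.last n)) ≤ 1 / 2)
    (ν : ℝ) (hν : ν ∈ Set.Icc (0 : ℝ) 1) :
    ν ^ Real.logb (GraphIso.indepRatio (H (Fin.last n)))
        (1 - GraphIso.indepRatio (H (Fin.last n))) ≤
      GraphIso.isoProfile (GraphIso.directProduct H) ν := by
  have hb0 := GraphIso.indepRatio_pos (H (Fin.last n))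
  have hHb := fun i => hmono i (Fin.last n) (Fin.le_last i)
  generalize GraphIso.indepRatio (H (Fin.last n)) = b at *
  have hb1 : b < 1 := by linarith
  have hc0 : 0 < Real.logb b (1 - b) :=
    Real.logb_pos_of_base_lt_one hb0 hb1 (by linarith) (by linarith)
  have hbc : b ^ Real.logb b (1 - b) = 1 - b :=
    Real.rpow_logb hb0 hb1.ne (by linarith)
  -- Equivalent to b ≤ 1 - b; Minkowski needs the exponent 1/c to be at least 1.
  have hc1 : Real.logb b (1 - b) ≤ 1 := by
    rw [Real.logb_le_iff_le_rpow_of_base_lt_one hb0 hb1 (by linarith), Real.rpow_one]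
    linarith
  obtain ⟨S, hS, hSx⟩ := (GraphIso.isLeast_isoProfile (GraphIso.directProduct H) hν.2).1
  rw [← hSx]
  exact (Real.rpow_le_rpow hν.1 hS hc0.le).trans
    (GraphIso.powerExpanding_pi hb1 hc0 hc1 hbc.le H hH hHb S)
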